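/- Let $(\mathfrak g,\langle\,,\rangle)$ be a Lorentzian Lie algebra: a finite-dimensional real Lie algebra with a nondegenerate symmetric bilinear form of signature $(1,n-1)=(-,+,\dots,+)$. The Levi-Civita product $\mathrm L:\mathfrak g\times\mathfrak g\to\mathfrak g$ is defined by $$2\langle \mathrm L_uv,w\rangle=\langle[u,v],w\rangle+\langle[w,u],v\rangle+\langle[w,v],u\rangle,$$ the curvature by $K(u,v)=\mathrm L_{[u,v]}-[\mathrm L_u,\mathrm L_v]$, and the Ricci operator by $\langle\mathrm{Ric}(u),v\rangle=\mathrm{tr}(w\mapsto K(u,w)v)$. The algebra is called Einstein if $\mathrm{Ric}=\lambda\,\mathrm{Id}_{\mathfrak g}$ for some $\lambda\in\mathbb R$, flat if $K=0$, and unimodular if $\mathrm{tr}(\mathrm{ad}_u)=0$ for all $u\in\mathfrak g$. Suppose that $(\mathfrak g,\langle\,,\rangle)$ is Einstein, solvable and unimodular, and that the restriction of $\langle\,,\rangle$ to the center $Z(\mathfrak g)$ is nondegenerate. Then at least one of the following holds. 1. $Z(\mathfrak g)$ is Euclidean, i.e. the restriction of $\langle\,,\rangle$ to $Z(\mathfrak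 g)$ is positive definite (this includes the case $Z(\mathfrak g)=0$). 2. $(\mathfrak g,\langle\,,\rangle)$ is flat, and $\mathfrak g=\mathfrak b\oplus\mathfrak a$ as a direct sum of vector spaces, where $\mathfrak b$ is an abelian ideal and $\mathfrak a$ an abelian subalgebra of $\mathfrak g$ such that $\mathrm L_u=\mathrm{ad}_u$ for all $u\in\mathfrak a$ and $\mathrm L_u=0$ for all $u\in\mathfrak b$. -/

import Mathlib

namespace LorentzLie

section

variable {V : Type*} [AddCommGroup V] [Module ℝ V]

/-- A bilinear form is Euclidean if it is a symmetric nondegenerate form of signature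
`(-,…,-,+,…,+) = (0, n)`, i.e. symmetric and positive definite. The zero space is Euclidean. -/
def IsEuclidean (B : LinearMap.BilinForm ℝ V) : Prop :=
  B.IsSymm ∧ B.toQuadraticMap.PosDef

/-- A bilinear form is Lorentzian if it is symmetric, nondegenerate and of signature
`(1, n - 1)`: exactly one negative direction. -/
structure IsLorentzian (B : LinearMap.BilinForm ℝ V) : Prop where
  isSymm : B.IsSymm
  nondegenerate : B.Nondegenerate
  sigNeg_eq_one : sigNeg B.toQuadraticMap = 1

end

section

variable {g : Type*} [LieRing g] [LieAlgebra ℝ g]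

/-- A Lie algebra is unimodular if `tr (ad u) = 0` for every `u`. -/
def IsUnimodular (g : Type*) [LieRing g] [LieAlgebra ℝ g] : Prop :=
  ∀ u : g, LinearMap.trace ℝ g (LieAlgebra.ad ℝ g u) = 0

/-- The linear form `w ↦ (⟨[u,v],w⟩ + ⟨[w,u],v⟩ + ⟨[w,v],u⟩) / 2`, as a bilinear map in
`(u, v)`. -/
noncomputable def koszulForm (B : LinearMap.BilinForm ℝ g) :
    g →ₗ[ℝ] g →ₗ[ℝ] Module.Dual ℝ g :=
  LinearMap.mk₂ ℝ
    (fun u v =>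
      { toFun := fun w => (1 / 2 : ℝ) * (B ⁅u, v⁆ w + B ⁅w, u⁆ v + B ⁅w, v⁆ u)
        map_add' := by intro x y; simp only [add_lie, map_add, LinearMap.add_apply]; ring
        map_smul' := by
          intro c x
          simp only [smul_lie, map_smul, LinearMap.smul_apply, smul_eq_mul, RingHom.id_apply]
          ring })
    (by
      intro u u' v; ext w
      simp only [LinearMap.coe_mk, AddHom.coe_mk, add_lie, lie_add, map_add, LinearMap.add_apply]
      ring)
    (by
      intro c u v; ext w
      simp only [LinearMap.coe_mk, AddHom.coe_mk, smul_lie, lie_smul, map_smul,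
        LinearMap.smul_apply, smul_eq_mul]
      ring)
    (by
      intro u v v'; ext w
      simp only [LinearMap.coe_mk, AddHom.coe_mk, lie_add, map_add, LinearMap.add_apply]
      ring)
    (by
      intro c u v; ext w
      simp only [LinearMap.coe_mk, AddHom.coe_mk, lie_smul, map_smul,
        LinearMap.smul_apply, smul_eq_mul]
      ring)

variable [FiniteDimensional ℝ g]

/-- The Levi-Civita product `L_u v` of a nondegenerate form `B` on `g`: the vector dual, with
respect to `B`, to the linear form `koszulForm B u v`. -/
noncomputable def leviCivita (B : LinearMap.BilinForm ℝ g) (hB : B.Nondegenerate) :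
    g →ₗ[ℝ] Module.End ℝ g :=
  (koszulForm B).compr₂ (B.toDual hB).symm.toLinearMap

/-- Koszul's formula. -/
theorem two_mul_leviCivita (B : LinearMap.BilinForm ℝ g) (hB : B.Nondegenerate) (u v w : g) :
    2 * B (leviCivita B hB u v) w = B ⁅u, v⁆ w + B ⁅w, u⁆ v + B ⁅w, v⁆ u := by
  have h : B (leviCivita B hB u v) w = koszulForm B u v w :=
    LinearMap.BilinForm.apply_toDual_symm_apply (hB := hB) (koszulForm B u v) w
  rw [h]
  simp only [koszulForm, LinearMap.mk₂_apply, LinearMap.coe_mk, AddHom.coe_mk]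
  ring

/-- The curvature `K(u, v) = L_{[u,v]} - [L_u, L_v]`, as a bilinear map in `(u, v)`. -/
noncomputable def curvature (B : LinearMap.BilinForm ℝ g) (hB : B.Nondegenerate) :
    g →ₗ[ℝ] g →ₗ[ℝ] Module.End ℝ g :=
  LinearMap.mk₂ ℝ (fun u v => leviCivita B hB ⁅u, v⁆ - ⁅leviCivita B hB u, leviCivita B hB v⁆)
    (by intro u u' v; simp only [add_lie, map_add, LieRing.of_associative_ring_bracket, add_mul, mul_add]; abel)
    (by intro c u v; simp only [smul_lie, map_smul, LieRing.of_associative_ring_bracket, smul_mul_assoc, mul_smul_comm, smul_sub])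
    (by intro u v v'; simp only [lie_add, map_add, LieRing.of_associative_ring_bracket, add_mul, mul_add]; abel)
    (by intro c u v; simp only [lie_smul, map_smul, LieRing.of_associative_ring_bracket, smul_mul_assoc, mul_smul_comm, smul_sub])

/-- The Ricci curvature `ric(u, v) = tr (w ↦ K(u, w) v)`. -/
noncomputable def ricci (B : LinearMap.BilinForm ℝ g) (hB : B.Nondegenerate) :
    LinearMap.BilinForm ℝ g :=
  LinearMap.mk₂ ℝ (fun u v => LinearMap.trace ℝ g ((curvature B hB u).flip v))
    (by intro u u' v; rw [← map_add]; congr 1; ext w; simp)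
    (by intro c u v; rw [← map_smul]; congr 1; ext w; simp)
    (by intro u v v'; simp only [map_add])
    (by intro c u v; simp only [map_smul])

/-- The Ricci operator, defined by `⟨Ric u, v⟩ = ric(u, v)`. -/
noncomputable def ricciOperator (B : LinearMap.BilinForm ℝ g) (hB : B.Nondegenerate) :
    Module.End ℝ g :=
  (B.toDual hB).symm.toLinearMap ∘ₗ ricci B hB

/-- `(g, B)` is Einstein if `Ric = λ Id` for some real constant `λ`. -/
def IsEinstein (B : LinearMap.BilinForm ℝ g) (hB : B.Nondegenerate) : Prop :=
  ∃ c : ℝ, ricciOperator B hB = c • LinearMap.id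

/-- `(g, B)` is flat if its curvature vanishes. -/
def IsFlat (B : LinearMap.BilinForm ℝ g) (hB : B.Nondegenerate) : Prop :=
  ∀ u v : g, curvature B hB u v = 0

end

end LorentzLie

/-!
Suppose the centre is nondegenerate but not Euclidean. It then contains a vector `e` with
`⟨e, e⟩ = -1`, and `e⊥` is positive definite because the signature is `(1, n - 1)`. For an
orthonormal basis `xᵢ` of `e⊥`, unimodularity reduces the Ricci curvature to
`ric(u, u) = -tr (R_u ∘ R_u)` with `R_u w = L_w u`. In coordinates (`einstein_apply_self`), an
Einstein metric with constant `c` satisfies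
`c ⟨u, u⟩ = 1/2 ∑ⱼ ⟨[u, xⱼ], e⟩² - 1/4 ∑ᵢⱼ ((⟨[u, xᵢ], xⱼ⟩ + ⟨[u, xⱼ], xᵢ⟩)² - ⟨[xᵢ, xⱼ], u⟩²)`.

*The Einstein constant is zero.* Taking `u = e` gives `-c = 1/4 ∑ᵢⱼ ⟨[xᵢ, xⱼ], e⟩² ≥ 0`.
Conversely, let `D` be the last term of the derived series not contained in `ℝ e`; modulo `e` it is
an abelian ideal. Summing the formula over an orthonormal basis of the projection of `D` to `e⊥`,
the two inner sums combine to something nonnegative (`sum_symmetrized_sq_le`) while the first sum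
enters with the favourable sign, as `e` is timelike; hence `c ≥ 0`. So `c = 0`, and then
`⟨[u, v], e⟩ = 0` for all `u`, `v`: the derived algebra lies in the Euclidean space `e⊥`.

*The structure of `g`.* If `u` is orthogonal to `[g, g]`, the formula says that a sum of squares
vanishes, i.e. that `ad u` is skew; this makes `[g, g]⊥` an abelian subalgebra. For `u` in `[g, g]`
the operator `ad u` is nilpotent by Lie's theorem, so `tr (ad u)² = 0`, and summing the formula over
an orthonormal basis of `[g, g]` forces `[g, g]` to be abelian
(`eq_zero_of_sum_symmetrized_sq_eq`). Finally `b = [g, g]` and `a = [g, g]⊥` are the required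
summands: Koszul's formula gives `L = ad` on `a` and `L = 0` on `b`, whence flatness.
-/

namespace LorentzLie

/-! ### The derived algebra of a solvable Lie algebra acts nilpotently -/

theorem lie_mem_derivedSeries_one {R L : Type*} [CommRing R] [LieRing L] [LieAlgebra R L]
    (y z : L) : ⁅y, z⁆ ∈ LieAlgebra.derivedSeries R L 1 :=
  LieSubmodule.lie_mem_lie (LieSubmodule.mem_top y) (LieSubmodule.mem_top z)

theorem derivedSeries_one_le {R L : Type*} [CommRing R] [LieRing L] [LieAlgebra R L]
    {W : Submodule R L} (hW : ∀ y z : L, ⁅y, z⁆ ∈ W) :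
    (LieAlgebra.derivedSeries R L 1).toSubmodule ≤ W := by
  rw [LieAlgebra.derivedSeries_def, LieAlgebra.derivedSeriesOfIdeal_succ,
    LieSubmodule.lieIdeal_oper_eq_linear_span', Submodule.span_le]
  rintro _ ⟨y, -, z, -, rfl⟩
  exact hW y z

theorem weight_apply_eq_zero_of_mem_derivedSeries {K L V : Type*} [Field K] [LieRing L]
    [LieAlgebra K L] [AddCommGroup V] [Module K V] [LieRingModule L V] [LieModule K L V]
    (χ : Module.Dual K L) [Nontrivial (LieModule.weightSpace V χ)] {x : L}
    (hx : x ∈ LieAlgebra.derivedSeries K L 1) : χ x = 0 := by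
  obtain ⟨⟨v, hv⟩, hv0⟩ := exists_ne (0 : LieModule.weightSpace V χ)
  rw [LieModule.mem_weightSpace] at hv
  have hv0 : v ≠ 0 := fun h => hv0 (by simp [h])
  refine derivedSeries_one_le (W := LinearMap.ker χ) (fun a b => ?_) hx
  have h := hv ⁅a, b⁆
  rw [lie_lie, hv a, hv b, lie_smul, lie_smul, hv a, hv b, smul_smul, smul_smul, mul_comm,
    sub_self] at h
  exact (smul_eq_zero.mp h.symm).resolve_right hv0

/-- Induction on the dimension of the module: by Lie's theorem there is a nonzero weight space `W`;
its weight kills the derived algebra, which therefore acts by zero on `W` and, by induction,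
nilpotently on the quotient. -/
theorem isNilpotent_toEnd_of_mem_derivedSeries_of_isAlgClosed {K L : Type*} [Field K] [CharZero K]
    [IsAlgClosed K] [LieRing L] [LieAlgebra K L] [LieAlgebra.IsSolvable L] (V : Type*)
    [AddCommGroup V] [Module K V] [LieRingModule L V] [LieModule K L V] [FiniteDimensional K V]
    {x : L} (hx : x ∈ LieAlgebra.derivedSeries K L 1) :
    IsNilpotent (LieModule.toEnd K L V x) := by
  cases subsingleton_or_nontrivial V with
  | inl h => exact ⟨1, LinearMap.ext fun v => Subsingleton.elim _ _⟩
  | inr h =>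
    obtain ⟨χ, hχ⟩ := LieModule.exists_nontrivial_weightSpace_of_isSolvable K L V
    have hx0 : χ x = 0 := weight_apply_eq_zero_of_mem_derivedSeries (V := V) χ hx
    set W : LieSubmodule K L V := LieModule.weightSpace V χ with hW
    have hdec : Module.finrank K (V ⧸ W.toSubmodule) < Module.finrank K V := by
      have h1 := W.toSubmodule.finrank_quotient_add_finrank
      have h2 : 0 < Module.finrank K W.toSubmodule := Module.finrank_pos (R := K) (M := W)
      omega
    obtain ⟨n, hn⟩ : IsNilpotent (LieModule.toEnd K L (V ⧸ W) x) :=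
      isNilpotent_toEnd_of_mem_derivedSeries_of_isAlgClosed (V ⧸ W) hx
    have hq : ∀ (m : ℕ) (v : V), (LieModule.toEnd K L (V ⧸ W) x ^ m) (LieSubmodule.Quotient.mk v) =
        LieSubmodule.Quotient.mk ((LieModule.toEnd K L V x ^ m) v) := by
      intro m v
      induction m with
      | zero => simp
      | succ m ih =>
        rw [pow_succ', pow_succ', Module.End.mul_apply, Module.End.mul_apply, ih]
        rfl
    refine ⟨n + 1, LinearMap.ext fun v => ?_⟩
    have hmem : (LieModule.toEnd K L V x ^ n) v ∈ W := by
      have h := hq n v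
      rw [hn, LinearMap.zero_apply] at h
      exact (LieSubmodule.Quotient.mk_eq_zero' (N := W)).mp h.symm
    rw [hW, LieModule.mem_weightSpace] at hmem
    rw [pow_succ', Module.End.mul_apply, LieModule.toEnd_apply_apply, hmem x, hx0, zero_smul,
      LinearMap.zero_apply]
termination_by Module.finrank K V

open scoped TensorProduct in
/-- Nilpotency is checked after extension of scalars to `ℂ`, where Lie's theorem applies. -/
theorem isNilpotent_ad_of_mem_derivedSeries {L : Type*} [LieRing L] [LieAlgebra ℝ L]
    [FiniteDimensional ℝ L] [LieAlgebra.IsSolvable L] {x : L}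
    (hx : x ∈ LieAlgebra.derivedSeries ℝ L 1) : IsNilpotent (LieAlgebra.ad ℝ L x) := by
  have : LieAlgebra.IsSolvable (ℂ ⊗[ℝ] L) :=
    (LieAlgebra.isSolvable_tensorProduct_iff ℝ L).mpr inferInstance
  have hx' : (1 : ℂ) ⊗ₜ[ℝ] x ∈ LieAlgebra.derivedSeries ℂ (ℂ ⊗[ℝ] L) 1 := by
    rw [LieAlgebra.derivedSeries_baseChange]
    exact Submodule.tmul_mem_baseChange_of_mem 1 hx
  have h := isNilpotent_toEnd_of_mem_derivedSeries_of_isAlgClosed (ℂ ⊗[ℝ] L) hx'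
  rw [LieModule.toEnd_baseChange] at h
  exact (IsNilpotent.map_iff (f := Module.End.baseChangeHom ℝ ℂ L)
    (LinearMap.baseChangeHom_injective ℝ L ℂ)).mp h

theorem trace_ad_sq_eq_zero_of_mem_derivedSeries {L : Type*} [LieRing L] [LieAlgebra ℝ L]
    [FiniteDimensional ℝ L] [LieAlgebra.IsSolvable L] {x : L}
    (hx : x ∈ LieAlgebra.derivedSeries ℝ L 1) :
    LinearMap.trace ℝ L (LieAlgebra.ad ℝ L x * LieAlgebra.ad ℝ L x) = 0 :=
  (LinearMap.isNilpotent_trace_of_isNilpotent ((Commute.refl _).isNilpotent_mul_right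
    (isNilpotent_ad_of_mem_derivedSeries hx))).eq_zero

/-! ### Lorentzian forms -/

section BilinForm

variable {V : Type*} [AddCommGroup V] [Module ℝ V]

theorem exists_apply_self_neg {B : LinearMap.BilinForm ℝ V} (hs : B.IsSymm) (hB : B.Nondegenerate)
    (h : ¬ B.toQuadraticMap.PosDef) : ∃ v, B v v < 0 := by
  simp only [QuadraticMap.PosDef, LinearMap.BilinMap.toQuadraticMap_apply, not_forall,
    not_lt] at h
  obtain ⟨z, hz, hzz⟩ := h
  rcases hzz.lt_or_eq with hlt | h0
  · exact ⟨z, hlt⟩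
  obtain ⟨w, hw⟩ : ∃ w, B z w ≠ 0 := by
    by_contra! hall
    exact hz (hB.1 z hall)
  -- `z` is a null vector, so `⟨w - t z, w - t z⟩ = ⟨w, w⟩ - 2 t ⟨z, w⟩`; this `t` makes it `-1`.
  refine ⟨w - ((B w w + 1) / (2 * B z w)) • z, ?_⟩
  have hwz : B w z = B z w := (hs.eq w z)
  simp only [map_sub, map_smul, LinearMap.sub_apply, LinearMap.smul_apply, smul_eq_mul, hwz, h0]
  have h1 : (B w w + 1) / (2 * B z w) * B z w = (B w w + 1) / 2 := by field_simp
  rw [mul_zero, sub_zero, h1]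
  linarith

variable [FiniteDimensional ℝ V]

/-- The orthogonal complement of a timelike vector `e` is positive definite: it is nondegenerate,
so otherwise it would contain a vector `v` with `⟨v, v⟩ < 0`, and `e`, `v` would span a negative
definite plane. -/
theorem IsLorentzian.pos_of_orthogonal {B : LinearMap.BilinForm ℝ V} (hB : IsLorentzian B) {e : V}
    (he : B e e < 0) {w : V} (hw : B w e = 0) (hw0 : w ≠ 0) : 0 < B w w := by
  by_contra! hcon
  have hs : ∀ x y, B x y = B y x := fun x y => hB.isSymm.eq x y
  set W := B.orthogonal (Submodule.span ℝ {e}) with hWdef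
  have hmem : ∀ x, x ∈ W ↔ B e x = 0 := by
    intro x
    rw [hWdef, LinearMap.BilinForm.mem_orthogonal_iff]
    refine ⟨fun h => h e (Submodule.mem_span_singleton_self e), fun h y hy => ?_⟩
    obtain ⟨c, rfl⟩ := Submodule.mem_span_singleton.mp hy
    simp [h]
  have hnd : (B.restrict W).Nondegenerate :=
    LinearMap.BilinForm.restrict_nondegenerate_orthogonal_spanSingleton B hB.nondegenerate
      hB.isSymm.isRefl he.ne
  have hnp : ¬ (B.restrict W).toQuadraticMap.PosDef := by
    intro hp
    have := hp ⟨w, (hmem w).2 (by rw [hs, hw])⟩ (by simpa [Subtype.ext_iff] using hw0)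
    simp at this
    linarith
  obtain ⟨⟨v, hv⟩, hvv⟩ := exists_apply_self_neg
    (B := B.restrict W) ⟨fun x y => hs x y⟩ hnd hnp
  replace hv := (hmem v).1 hv
  replace hvv : B v v < 0 := hvv
  have hli : LinearIndependent ℝ ![e, v] := by
    rw [LinearIndependent.pair_iff]
    intro s t hst
    have h1 : B e (s • e + t • v) = 0 := by rw [hst, map_zero]
    have h2 : B v (s • e + t • v) = 0 := by rw [hst, map_zero]
    simp only [map_add, map_smul, smul_eq_mul, hv, hs v e, mul_zero, add_zero, zero_add] at h1 h2
    exact ⟨(mul_eq_zero.mp h1).resolve_right he.ne, (mul_eq_zero.mp h2).resolve_right hvv.ne⟩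
  have hrank : Module.finrank ℝ (Submodule.span ℝ (Set.range ![e, v])) = 2 := by
    simpa using finrank_span_eq_card hli
  have hle := le_sigNeg_of_negDef B.toQuadraticMap
    (V := Submodule.span ℝ (Set.range ![e, v])) (by
      rintro ⟨x, hx⟩ hx0
      have hx' := hx
      simp only [Matrix.range_cons, Matrix.range_empty, Set.union_empty, Set.singleton_union] at hx'
      obtain ⟨s, t, rfl⟩ := Submodule.mem_span_pair.mp hx'
      have : 0 < -(B (s • e + t • v) (s • e + t • v)) := by
        simp only [map_add, map_smul, LinearMap.add_apply, LinearMap.smul_apply, smul_eq_mul, hv,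
          hs v e, mul_zero, add_zero, zero_add]
        by_cases hs0 : s = 0
        · have ht0 : t ≠ 0 := by
            rintro rfl
            simp [hs0] at hx0
          subst hs0
          linarith [mul_pos (mul_self_pos.2 ht0) (neg_pos.2 hvv)]
        · linarith [mul_pos (mul_self_pos.2 hs0) (neg_pos.2 he),
            mul_nonneg (mul_self_nonneg t) (neg_pos.2 hvv).le]
      simpa using this)
  rw [hrank, hB.sigNeg_eq_one] at hle
  omega

/-- A subspace on which `B` is positive definite has an orthonormal basis. -/
theorem exists_orthonormal_basis {B : LinearMap.BilinForm ℝ V} (hs : B.IsSymm) (P : Submodule ℝ V)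
    (hP : ∀ x ∈ P, x ≠ 0 → 0 < B x x) :
    ∃ x : Fin (Module.finrank ℝ P) → V, (∀ i, x i ∈ P) ∧
      (∀ i j, B (x i) (x j) = if i = j then 1 else 0) ∧
      ∀ v ∈ P, v ∈ Submodule.span ℝ (Set.range x) := by
  obtain ⟨b, hb⟩ := LinearMap.BilinForm.exists_orthogonal_basis
    (B := B.restrict P) ⟨fun x y => hs.eq x y⟩
  have hpos : ∀ i, 0 < B (b i) (b i) := fun i =>
    hP _ (b i).2 (fun h => b.ne_zero i (Subtype.ext h))
  have hc : ∀ i, (Real.sqrt (B (b i) (b i)))⁻¹ ≠ 0 := fun i =>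
    inv_ne_zero (Real.sqrt_pos.2 (hpos i)).ne'
  refine ⟨fun i => (Real.sqrt (B (b i) (b i)))⁻¹ • (b i : V), fun i => P.smul_mem _ (b i).2, ?_, ?_⟩
  · intro i j
    simp only [map_smul, LinearMap.smul_apply, smul_eq_mul]
    split_ifs with h
    · subst h
      have h1 := Real.mul_self_sqrt (hpos i).le
      have h2 := (Real.sqrt_pos.2 (hpos i)).ne'
      field_simp
      rw [pow_two, h1]
    · have : B (b i) (b j) = 0 := hb h
      rw [this]; ring
  · intro v hv
    have h1 : (⟨v, hv⟩ : P) ∈ Submodule.span ℝ (Set.range b) := by rw [b.span_eq]; trivial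
    have h2 : v ∈ (Submodule.span ℝ (Set.range b)).map P.subtype := ⟨⟨v, hv⟩, h1, rfl⟩
    rw [Submodule.map_span] at h2
    refine (Submodule.span_le.2 ?_) h2
    rintro _ ⟨_, ⟨i, rfl⟩, rfl⟩
    have := Submodule.smul_mem _ (Real.sqrt (B (b i) (b i))) (Submodule.subset_span (R := ℝ)
      (Set.mem_range_self (f := fun i => (Real.sqrt (B (b i) (b i)))⁻¹ • (b i : V)) i))
    simpa [smul_smul, mul_inv_cancel₀ (Real.sqrt_pos.2 (hpos i)).ne'] using this

end BilinForm
/-- The vectors `e`, `x i` form a pseudo-orthonormal basis in which `e` is timelike. Spanning is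
encoded by the expansion of a vector in terms of its scalar products. The relations `⟨xᵢ, xⱼ⟩ = 0`
for `i ≠ j` are not listed, as `1 = ⟨xᵢ, xᵢ⟩ = ∑ⱼ ⟨xᵢ, xⱼ⟩²` implies them. -/
structure IsTimelikeFrame {V ι : Type*} [AddCommGroup V] [Module ℝ V] [Fintype ι]
    (B : LinearMap.BilinForm ℝ V) (e : V) (x : ι → V) : Prop where
  symm : ∀ u v, B u v = B v u
  apply_timelike : B e e = -1
  orthogonal : ∀ i, B (x i) e = 0
  apply_self : ∀ i, B (x i) (x i) = 1
  expansion : ∀ v, v = ∑ i, B v (x i) • x i - B v e • e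

namespace IsTimelikeFrame

variable {V ι : Type*} [AddCommGroup V] [Module ℝ V] [Fintype ι] {B : LinearMap.BilinForm ℝ V}
  {e : V} {x : ι → V}

theorem apply_eq (h : IsTimelikeFrame B e x) (u v : V) :
    B u v = ∑ i, B u (x i) * B v (x i) - B u e * B v e := by
  conv_lhs => rw [h.expansion u]
  simp only [map_sub, map_sum, map_smul, LinearMap.sub_apply, LinearMap.sum_apply,
    LinearMap.smul_apply, smul_eq_mul, h.symm _ v]

theorem trace_eq [FiniteDimensional ℝ V] (h : IsTimelikeFrame B e x) (f : Module.End ℝ V) :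
    LinearMap.trace ℝ V f = ∑ i, B (f (x i)) (x i) - B (f e) e := by
  have hf : f = ∑ i, (B (x i)).smulRight (f (x i)) - (B e).smulRight (f e) := by
    ext v
    conv_lhs => rw [h.expansion v]
    simp [h.symm v]
  conv_lhs => rw [hf]
  simp [LinearMap.trace_smulRight, h.symm _ (x _), h.symm _ e]

theorem trace_mul_self [FiniteDimensional ℝ V] (h : IsTimelikeFrame B e x) (f : Module.End ℝ V) :
    LinearMap.trace ℝ V (f * f) = ∑ i, ∑ j, B (f (x i)) (x j) * B (f (x j)) (x i)
      - 2 * ∑ i, B (f (x i)) e * B (f e) (x i) + B (f e) e * B (f e) e := by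
  have key : ∀ u v, B (f (f u)) v = ∑ j, B (f u) (x j) * B (f (x j)) v - B (f u) e * B (f e) v := by
    intro u v
    conv_lhs => rw [h.expansion (f u)]
    simp
  rw [h.trace_eq]
  simp only [Module.End.mul_apply, key, Finset.sum_sub_distrib]
  have : ∑ i, B (f e) (x i) * B (f (x i)) e = ∑ i, B (f (x i)) e * B (f e) (x i) :=
    Finset.sum_congr rfl fun i _ => mul_comm _ _
  rw [this]
  ring

end IsTimelikeFrame

/-- A timelike unit vector `e` can be completed to a frame adapted to a subspace `P` of `e⊥`:
the vectors indexed by `S` lie in `P`, the other ones are orthogonal to `P`. -/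
theorem exists_isTimelikeFrame {V : Type*} [AddCommGroup V] [Module ℝ V] [FiniteDimensional ℝ V]
    {B : LinearMap.BilinForm ℝ V} (hB : IsLorentzian B) {e : V} (he : B e e = -1)
    (P : Submodule ℝ V) (hP : ∀ v ∈ P, B v e = 0) :
    ∃ (ι : Type) (_ : Fintype ι) (x : ι → V) (S : Finset ι), IsTimelikeFrame B e x ∧
      (∀ i ∈ S, x i ∈ P) ∧ ∀ j ∉ S, ∀ v ∈ P, B v (x j) = 0 := by
  have hs : ∀ u v, B u v = B v u := fun u v => hB.isSymm.eq u v
  have hpos : ∀ {w}, B w e = 0 → w ≠ 0 → 0 < B w w :=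
    fun hw => hB.pos_of_orthogonal (by rw [he]; norm_num) hw
  let Q : Submodule ℝ V := B.orthogonal (P ⊔ Submodule.span ℝ {e})
  have hQP : ∀ w ∈ Q, ∀ v ∈ P, B v w = 0 := fun w hw v hv =>
    LinearMap.BilinForm.mem_orthogonal_iff.1 hw v (Submodule.mem_sup_left hv)
  have hQe : ∀ w ∈ Q, B w e = 0 := fun w hw => by
    rw [hs]
    exact LinearMap.BilinForm.mem_orthogonal_iff.1 hw e
      (Submodule.mem_sup_right (Submodule.mem_span_singleton_self e))
  have hmemQ : ∀ w, (∀ v ∈ P, B v w = 0) → B w e = 0 → w ∈ Q := by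
    intro w h1 h2
    refine LinearMap.BilinForm.mem_orthogonal_iff.2 fun y hy => ?_
    obtain ⟨v, hv, z, hz, rfl⟩ := Submodule.mem_sup.1 hy
    obtain ⟨c, rfl⟩ := Submodule.mem_span_singleton.mp hz
    simp [h1 v hv, hs e w, h2]
  obtain ⟨x, hxP, hxx, hxs⟩ := exists_orthonormal_basis hB.isSymm P
    (fun v hv h0 => hpos (hP v hv) h0)
  obtain ⟨y, hyQ, hyy, hys⟩ := exists_orthonormal_basis hB.isSymm Q
    (fun v hv h0 => hpos (hQe v hv) h0)
  have hexp : ∀ {n : ℕ} (z : Fin n → V), (∀ i j, B (z i) (z j) = if i = j then 1 else 0) →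
      ∀ v ∈ Submodule.span ℝ (Set.range z), v = ∑ i, B v (z i) • z i := by
    intro n z hz v hv
    obtain ⟨c, rfl⟩ := (Submodule.mem_span_range_iff_exists_fun ℝ).1 hv
    simp [hz]
  refine ⟨_, inferInstance, Sum.elim x y, Finset.univ.map Function.Embedding.inl,
    ⟨hs, he, ?_, ?_, ?_⟩, ?_, ?_⟩
  · rintro (i | j)
    · exact hP _ (hxP i)
    · exact hQe _ (hyQ j)
  · rintro (i | j)
    · simp [hxx]
    · simp [hyy]
  · intro v
    set p : V := ∑ i, B v (x i) • x i with hp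
    have hpP : p ∈ P := Submodule.sum_mem _ fun i _ => P.smul_mem _ (hxP i)
    have hr : v - p + B v e • e ∈ Q := by
      refine hmemQ _ (fun w hw => ?_) ?_
      · have h1 := hexp x hxx w (hxs w hw)
        have h2 : B w v = B w p := by
          conv_lhs => rw [h1]
          simp only [hp, map_sum, map_smul, LinearMap.sum_apply, LinearMap.smul_apply, smul_eq_mul,
            hs v]
          exact Finset.sum_congr rfl fun i _ => mul_comm _ _
        simp [h2, hP w hw]
      · simp [hP p hpP, he]
    have h3 := hexp y hyy _ (hys _ hr)
    have h4 : ∀ j, B (v - p + B v e • e) (y j) = B v (y j) := by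
      intro j
      simp [hQP _ (hyQ j) p hpP, hs e, hQe _ (hyQ j)]
    simp only [h4] at h3
    rw [Fintype.sum_sum_type]
    simp only [Sum.elim_inl, Sum.elim_inr]
    rw [← hp, ← h3]
    abel
  · intro i hi
    obtain ⟨i, -, rfl⟩ := Finset.mem_map.1 hi
    exact hxP i
  · rintro (j | j) hj v hv
    · exact absurd (Finset.mem_map_of_mem Function.Embedding.inl (Finset.mem_univ j)) hj
    · exact hQP _ (hyQ j) v hv

/-! ### Ricci curvature of a unimodular Lie algebra in a frame -/

section Ricci

variable {g ι : Type*} [LieRing g] [LieAlgebra ℝ g] [FiniteDimensional ℝ g] [Fintype ι]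
  {B : LinearMap.BilinForm ℝ g} {hB : B.Nondegenerate} {e : g} {x : ι → g}

/-- The Levi-Civita product is torsion free. -/
theorem leviCivita_sub_leviCivita (u v : g) :
    leviCivita B hB u v - leviCivita B hB v u = ⁅u, v⁆ := by
  have h0 : ∀ w, B (leviCivita B hB u v - leviCivita B hB v u - ⁅u, v⁆) w = 0 := by
    intro w
    have h1 := two_mul_leviCivita B hB u v w
    have h2 := two_mul_leviCivita B hB v u w
    rw [← lie_skew v u, map_neg, LinearMap.neg_apply] at h2
    simp only [map_sub, LinearMap.sub_apply]
    linarith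
  exact sub_eq_zero.mp (hB.1 _ h0)

/-- In a unimodular Lie algebra, `ric(u, u) = -tr (R_u ∘ R_u)` for `R_u : w ↦ L_w u`. Indeed
`w ↦ K(u, w) u` is `R_u ∘ ad u - L_u ∘ R_u + R_{L_u u}`, where `L_u = R_u + ad u` as the torsion
vanishes, and `tr R_v = -tr (ad v) = 0`. -/
theorem ricci_self (hx : IsTimelikeFrame B e x) (hg : IsUnimodular g) (u : g) :
    ricci B hB u u = -LinearMap.trace ℝ g
      ((leviCivita B hB).flip u * (leviCivita B hB).flip u) := by
  set L := leviCivita B hB with hL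
  have htors : ∀ v, L v = L.flip v + LieAlgebra.ad ℝ g v := by
    intro v
    ext w
    have := leviCivita_sub_leviCivita (hB := hB) v w
    simp [← this, hL]
  have htr : ∀ v, LinearMap.trace ℝ g (L.flip v) = 0 := by
    intro v
    have hdiag : ∀ w, B (L.flip v w) w = -B (LieAlgebra.ad ℝ g v w) w := by
      intro w
      have h := two_mul_leviCivita B hB w v w
      rw [lie_self, map_zero, LinearMap.zero_apply, ← lie_skew, map_neg, LinearMap.neg_apply] at h
      simp only [LinearMap.flip_apply, LieAlgebra.ad_apply, hL]
      linarith
    have h := hg v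
    rw [hx.trace_eq] at h ⊢
    simp only [hdiag, Finset.sum_neg_distrib]
    linarith
  have hmap : (curvature B hB u).flip u =
      L.flip u * LieAlgebra.ad ℝ g u - L u * L.flip u + L.flip (L u u) := by
    ext w
    simp [curvature, LieRing.of_associative_ring_bracket, hL]
    abel
  have hric : ricci B hB u u = LinearMap.trace ℝ g ((curvature B hB u).flip u) := rfl
  rw [hric, hmap, map_add, map_sub, htr, htors u, add_mul, map_add,
    LinearMap.trace_mul_comm ℝ (LieAlgebra.ad ℝ g u)]
  ring

/-- The Einstein equation `c ⟨u, u⟩ = ric(u, u)` in a frame whose timelike vector is central. The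
operator `-2 R_u` is the sum of the symmetric operator `ad u + (ad u)*` and of the skew operator
with form `(v, w) ↦ ⟨[v, w], u⟩`, so that `4 tr (R_u ∘ R_u)` is a difference of two sums of
squares with signs; the first sum in the statement collects the terms with exactly one index at `e`. -/
theorem einstein_apply_self (hx : IsTimelikeFrame B e x) (hg : IsUnimodular g)
    (he : ∀ v : g, ⁅e, v⁆ = 0) {c : ℝ} (hc : ricciOperator B hB = c • LinearMap.id) (u : g) :
    c * B u u = 1 / 2 * ∑ j, B ⁅u, x j⁆ e ^ 2 -
      1 / 4 * ∑ i, ∑ j, ((B ⁅u, x i⁆ (x j) + B ⁅u, x j⁆ (x i)) ^ 2 - B ⁅x i, x j⁆ u ^ 2) := by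
  have he' : ∀ v : g, ⁅v, e⁆ = 0 := fun v => by rw [← lie_skew, he, neg_zero]
  have h1 : c * B u u = ricci B hB u u := by
    have h2 : B (ricciOperator B hB u) u = ricci B hB u u :=
      LinearMap.BilinForm.apply_toDual_symm_apply (hB := hB) (ricci B hB u) u
    rw [← h2, hc]
    simp
  have hF : ∀ v w, B ((leviCivita B hB).flip u v) w =
      -(1 / 2) * (B ⁅u, v⁆ w + B ⁅u, w⁆ v + B ⁅v, w⁆ u) := by
    intro v w
    have h := two_mul_leviCivita B hB v u w
    rw [← lie_skew v u, ← lie_skew w u, ← lie_skew w v] at h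
    simp only [map_neg, LinearMap.neg_apply] at h
    rw [LinearMap.flip_apply]
    linarith
  rw [h1, ricci_self hx hg, hx.trace_mul_self]
  simp only [hF, he, he', map_zero, LinearMap.zero_apply, add_zero, mul_zero]
  have e1 : ∑ i, ∑ j, -(1 / 2) * (B ⁅u, x i⁆ (x j) + B ⁅u, x j⁆ (x i) + B ⁅x i, x j⁆ u) *
      (-(1 / 2) * (B ⁅u, x j⁆ (x i) + B ⁅u, x i⁆ (x j) + B ⁅x j, x i⁆ u)) =
      1 / 4 * ∑ i, ∑ j, ((B ⁅u, x i⁆ (x j) + B ⁅u, x j⁆ (x i)) ^ 2 - B ⁅x i, x j⁆ u ^ 2) := by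
    simp only [Finset.mul_sum]
    refine Finset.sum_congr rfl fun i _ => Finset.sum_congr rfl fun j _ => ?_
    rw [← lie_skew (x i) (x j), map_neg, LinearMap.neg_apply]
    ring
  have e2 : ∑ i, -(1 / 2) * B ⁅u, x i⁆ e * (-(1 / 2) * (0 + B ⁅u, x i⁆ e)) =
      1 / 4 * ∑ j, B ⁅u, x j⁆ e ^ 2 := by
    simp only [Finset.mul_sum]
    exact Finset.sum_congr rfl fun i _ => by ring
  rw [e1, e2]
  ring

end Ricci

/-! ### Sums of squares of structure constants -/

theorem eq_zero_of_sum_sum_sq_eq_zero {ι κ : Type*} {s : Finset ι} {t : Finset κ}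
    {f : ι → κ → ℝ} (h : ∑ i ∈ s, ∑ j ∈ t, f i j ^ 2 = 0) {i : ι} (hi : i ∈ s) {j : κ}
    (hj : j ∈ t) : f i j = 0 := by
  have h1 := (Finset.sum_eq_zero_iff_of_nonneg fun i _ =>
    Finset.sum_nonneg fun j _ => sq_nonneg (f i j)).1 h i hi
  have h2 := (Finset.sum_eq_zero_iff_of_nonneg fun j _ => sq_nonneg (f i j)).1 h1 j hj
  exact (pow_eq_zero_iff two_ne_zero).1 h2

section StructureConstants

variable {ι : Type*} [Fintype ι] {c : ι → ι → ι → ℝ} {S : Finset ι}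

/-- Here `c i j k` stands for `⟨[xᵢ, xⱼ], xₖ⟩` and `S` indexes a basis of an abelian ideal. Both
sides contain twice the sum of the `c i j k ^ 2` with `i, k ∈ S` and `j ∉ S`; the left hand side has
no other term. -/
theorem sum_symmetrized_sq_le (hskew : ∀ i j k, c i j k = -c j i k)
    (hideal : ∀ k ∈ S, ∀ i, ∀ j ∉ S, c k i j = 0) (habel : ∀ k ∈ S, ∀ i ∈ S, ∀ j, c k i j = 0) :
    ∑ k ∈ S, ∑ i, ∑ j, (c k i j + c k j i) ^ 2 ≤ ∑ k ∈ S, ∑ i, ∑ j, c i j k ^ 2 := by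
  classical
  have hT : ∀ k ∈ S, ∑ i, ∑ j, (c k i j + c k j i) ^ 2 = 2 * ∑ j ∈ S, ∑ i, c k i j ^ 2 := by
    intro k hk
    have h1 : ∀ i j, (c k i j + c k j i) ^ 2 = c k i j ^ 2 + c k j i ^ 2 := by
      intro i j
      by_cases hj : j ∈ S
      · rw [habel k hk j hj i]; ring
      · rw [hideal k hk i j hj]; ring
    have h2 : ∑ j, ∑ i, c k i j ^ 2 = ∑ j ∈ S, ∑ i, c k i j ^ 2 :=
      (Finset.sum_subset (Finset.subset_univ S) fun j _ hj =>
        Finset.sum_eq_zero fun i _ => by rw [hideal k hk i j hj]; ring).symm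
    simp only [h1, Finset.sum_add_distrib]
    rw [Finset.sum_comm, h2]
    ring
  have hR : ∀ k ∈ S, 2 * ∑ i ∈ S, ∑ j, c i j k ^ 2 ≤ ∑ i, ∑ j, c i j k ^ 2 := by
    intro k hk
    have h1 : ∑ i ∈ S, ∑ j, c i j k ^ 2 = ∑ i, ∑ j, if i ∈ S then c i j k ^ 2 else 0 := by
      rw [← Finset.sum_filter_add_sum_filter_not Finset.univ (· ∈ S)
        (fun i => ∑ j, if i ∈ S then c i j k ^ 2 else 0)]
      rw [Finset.sum_eq_zero (s := Finset.univ.filter (· ∉ S)), add_zero]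
      · refine Finset.sum_congr (by ext; simp) fun i hi => Finset.sum_congr rfl fun j _ => ?_
        rw [if_pos (by simpa using hi)]
      · intro i hi
        exact Finset.sum_eq_zero fun j _ => if_neg (by simpa using hi)
    have h2 : ∑ i ∈ S, ∑ j, c i j k ^ 2 = ∑ i, ∑ j, if j ∈ S then c i j k ^ 2 else 0 := by
      rw [h1, Finset.sum_comm]
      refine Finset.sum_congr rfl fun i _ => Finset.sum_congr rfl fun j _ => ?_
      rw [hskew i j k, neg_sq]
    rw [two_mul]
    nth_rewrite 1 [h1]
    rw [h2, ← Finset.sum_add_distrib]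
    refine Finset.sum_le_sum fun i _ => ?_
    rw [← Finset.sum_add_distrib]
    refine Finset.sum_le_sum fun j _ => ?_
    by_cases hi : i ∈ S
    · by_cases hj : j ∈ S
      · simp [habel i hi j hj k]
      · simp [hi, hj]
    · by_cases hj : j ∈ S
      · simp [hi, hj]
      · simp [hi, hj, sq_nonneg]
  rw [Finset.sum_congr rfl hT]
  refine le_trans (le_of_eq ?_) (Finset.sum_le_sum hR)
  rw [← Finset.mul_sum, ← Finset.mul_sum]
  congr 1
  exact Finset.sum_comm

/-- Here `c i j k` stands for `⟨[xᵢ, xⱼ], xₖ⟩` and `S` indexes a basis of the derived algebra, whose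
orthogonal complement is assumed abelian (`hcompl`). Summing `hric` over `k ∈ S` and using `hkilling`
gives `2 ∑ f i j = ∑ f i j` for `f i j = ∑ₖ c i j k ^ 2`, with `i ∈ S` on the left and all `i` on the
right. Since `f` is symmetric, the difference of the two sides is the sum of `f` over `S × S`. -/
theorem eq_zero_of_sum_symmetrized_sq_eq (hskew : ∀ i j k, c i j k = -c j i k)
    (hcompl : ∀ i ∉ S, ∀ j ∉ S, ∀ k, c i j k = 0) (hderived : ∀ i j, ∀ k ∉ S, c i j k = 0)
    (hkilling : ∀ k ∈ S, ∑ i, ∑ j, c k i j * c k j i = 0)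
    (hric : ∀ k ∈ S, ∑ i, ∑ j, (c k i j + c k j i) ^ 2 = ∑ i, ∑ j, c i j k ^ 2) :
    ∀ i ∈ S, ∀ j ∈ S, ∀ k, c i j k = 0 := by
  classical
  set f : ι → ι → ℝ := fun i j => ∑ k, c i j k ^ 2 with hf
  have hf0 : ∀ i j, 0 ≤ f i j := fun i j => Finset.sum_nonneg fun k _ => sq_nonneg _
  have hfs : ∀ i j, f i j = f j i := fun i j =>
    Finset.sum_congr rfl fun k _ => by rw [hskew i j k, neg_sq]
  have h1 : ∀ k ∈ S, 2 * ∑ i, f k i = ∑ i, ∑ j, c i j k ^ 2 := by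
    intro k hk
    have h2 : ∀ i j, (c k i j + c k j i) ^ 2 =
        c k i j ^ 2 + c k j i ^ 2 + 2 * (c k i j * c k j i) := fun i j => by ring
    rw [← hric k hk]
    simp only [h2, Finset.sum_add_distrib, ← Finset.mul_sum, hkilling k hk]
    rw [Finset.sum_comm (f := fun i j => c k j i ^ 2)]
    ring
  have h2 : 2 * ∑ k ∈ S, ∑ i, f k i = ∑ i, ∑ j, f i j := by
    rw [Finset.mul_sum, Finset.sum_congr rfl h1,
      Finset.sum_subset (Finset.subset_univ S) fun k _ hk =>
        Finset.sum_eq_zero fun i _ => Finset.sum_eq_zero fun j _ => by rw [hderived i j k hk]; ring,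
      Finset.sum_comm]
    exact Finset.sum_congr rfl fun i _ => Finset.sum_comm
  have h3 : ∑ i, ∑ j, f i j = 2 * (∑ k ∈ S, ∑ i, f k i) - ∑ i ∈ S, ∑ j ∈ S, f i j := by
    have hA : ∑ i, ∑ j, f i j = ∑ i ∈ S, ∑ j, f i j + ∑ i ∈ Sᶜ, ∑ j, f i j :=
      (Finset.sum_add_sum_compl S _).symm
    have hB : ∑ i ∈ Sᶜ, ∑ j, f i j = ∑ i ∈ Sᶜ, ∑ j ∈ S, f i j := by
      refine Finset.sum_congr rfl fun i hi => ?_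
      refine (Finset.sum_subset (Finset.subset_univ S) fun j _ hj => ?_).symm
      exact Finset.sum_eq_zero fun k _ => by rw [hcompl i (by simpa using hi) j hj]; ring
    have hC : ∑ i ∈ S, ∑ j, f i j = ∑ i ∈ S, ∑ j ∈ S, f i j + ∑ i ∈ Sᶜ, ∑ j ∈ S, f i j := by
      rw [Finset.sum_comm (s := Sᶜ), ← Finset.sum_add_distrib]
      refine Finset.sum_congr rfl fun i _ => ?_
      rw [← Finset.sum_add_sum_compl S]
      congr 1
      exact Finset.sum_congr rfl fun j _ => hfs i j
    rw [hA, hB]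
    linarith
  have h4 : ∑ i ∈ S, ∑ j ∈ S, f i j = 0 := by linarith
  intro i hi j hj k
  have h5 := (Finset.sum_eq_zero_iff_of_nonneg fun i _ => Finset.sum_nonneg fun j _ => hf0 i j).1
    h4 i hi
  have h6 := (Finset.sum_eq_zero_iff_of_nonneg fun j _ => hf0 i j).1 h5 j hj
  have h7 := (Finset.sum_eq_zero_iff_of_nonneg fun k _ => sq_nonneg _).1 h6 k (Finset.mem_univ k)
  exact pow_eq_zero_iff two_ne_zero |>.1 h7

end StructureConstants

/-! ### Einstein metrics with a central timelike vector -/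

/-- If every element orthogonal to the derived algebra has a skew adjoint action, then two such
elements commute: `⟨[u, v], w⟩ = -⟨[u, w], v⟩ = 0` for every `w`. -/
theorem lie_eq_zero_of_orthogonal_derived {g : Type*} [LieRing g] [LieAlgebra ℝ g]
    {B : LinearMap.BilinForm ℝ g} (hB : B.Nondegenerate)
    (hskew : ∀ u, (∀ v w : g, B ⁅v, w⁆ u = 0) → ∀ v w : g, B ⁅u, v⁆ w = -B ⁅u, w⁆ v) {u v : g}
    (hu : ∀ y z : g, B ⁅y, z⁆ u = 0) (hv : ∀ y z : g, B ⁅y, z⁆ v = 0) : ⁅u, v⁆ = 0 :=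
  hB.1 _ fun w => by rw [hskew u hu, hv, neg_zero]

section Einstein

variable {g : Type*} [LieRing g] [LieAlgebra ℝ g] [FiniteDimensional ℝ g]
  {B : LinearMap.BilinForm ℝ g} {e : g} {c : ℝ}

theorem IsTimelikeFrame.einstein_timelike {ι : Type*} [Fintype ι] {x : ι → g} {hB : B.Nondegenerate}
    (hx : IsTimelikeFrame B e x) (hg : IsUnimodular g) (he : ∀ v : g, ⁅e, v⁆ = 0)
    (hc : ricciOperator B hB = c • LinearMap.id) :
    -c = 1 / 4 * ∑ i, ∑ j, B ⁅x i, x j⁆ e ^ 2 := by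
  have h := einstein_apply_self hx hg he hc e
  simp only [he, map_zero, LinearMap.zero_apply, hx.apply_timelike, add_zero] at h
  simp only [zero_sub, Finset.sum_neg_distrib, ne_eq, OfNat.ofNat_ne_zero, not_false_eq_true,
    zero_pow, Finset.sum_const_zero] at h
  linarith

/-- The Einstein equation is summed over a basis of the projection to `e⊥` of the last term of the
derived series which is not contained in `ℝ e`; modulo `e` that term is an abelian ideal. -/
theorem einstein_constant_nonneg (hB : IsLorentzian B) (hsol : LieAlgebra.IsSolvable g)
    (hg : IsUnimodular g) (hee : B e e = -1) (he : ∀ v : g, ⁅e, v⁆ = 0)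
    (hc : ricciOperator B hB.nondegenerate = c • LinearMap.id) : 0 ≤ c := by
  classical
  have hs : ∀ u v, B u v = B v u := fun u v => hB.isSymm.eq u v
  have he' : ∀ v : g, ⁅v, e⁆ = 0 := fun v => by rw [← lie_skew, he, neg_zero]
  have hex : ∃ k, (LieAlgebra.derivedSeries ℝ g k).toSubmodule ≤ Submodule.span ℝ {e} := by
    obtain ⟨k, hk⟩ := LieAlgebra.IsSolvable.solvable ℝ g
    exact ⟨k, by rw [hk]; simp⟩
  obtain ⟨k, hk, hmin⟩ : ∃ k, (LieAlgebra.derivedSeries ℝ g k).toSubmodule ≤ Submodule.span ℝ {e} ∧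
      ∀ l < k, ¬ (LieAlgebra.derivedSeries ℝ g l).toSubmodule ≤ Submodule.span ℝ {e} :=
    ⟨Nat.find hex, Nat.find_spec hex, fun l hl => Nat.find_min hex hl⟩
  cases k with
  | zero =>
    obtain ⟨ι, _, x, S, hx, -⟩ := exists_isTimelikeFrame hB hee ⊥ (by simp)
    have h0 : ∀ u v : g, ⁅u, v⁆ = 0 := by
      intro u v
      have hu : u ∈ LieAlgebra.derivedSeries ℝ g 0 := by simp
      obtain ⟨a, rfl⟩ := Submodule.mem_span_singleton.1 (hk hu)
      rw [smul_lie, he, smul_zero]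
    have := hx.einstein_timelike hg he hc
    simp [h0] at this
    exact this.ge
  | succ k =>
    set D := LieAlgebra.derivedSeries ℝ g k with hD
    have hDD : ∀ u ∈ D, ∀ v ∈ D, ⁅u, v⁆ ∈ Submodule.span ℝ {e} := fun u hu v hv => by
      refine hk ?_
      rw [LieAlgebra.derivedSeries_def, LieAlgebra.derivedSeriesOfIdeal_succ]
      exact LieSubmodule.lie_mem_lie hu hv
    -- the orthogonal projection of `D` to `e⊥`
    let P : Submodule ℝ g := (D.toSubmodule ⊔ Submodule.span ℝ {e}) ⊓ LinearMap.ker (B.flip e)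
    obtain ⟨ι, _, x, S, hx, hxS, hxS'⟩ := exists_isTimelikeFrame hB hee P (fun v hv => hv.2)
    have hDx : ∀ d ∈ D, ∀ j ∉ S, B d (x j) = 0 := by
      intro d hd j hj
      have hdP : d + B d e • e ∈ P := by
        refine ⟨Submodule.add_mem_sup hd (Submodule.smul_mem _ _
          (Submodule.mem_span_singleton_self e)), ?_⟩
        simp [hee]
      have := hxS' j hj _ hdP
      simpa [hs e, hx.orthogonal] using this
    have hSD : ∀ i ∈ S, ∃ d ∈ D, ∃ a : ℝ, x i = d + a • e := by
      intro i hi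
      obtain ⟨d, hd, z, hz, h⟩ := Submodule.mem_sup.1 (hxS i hi).1
      obtain ⟨a, rfl⟩ := Submodule.mem_span_singleton.1 hz
      exact ⟨d, hd, a, h.symm⟩
    have hSne : S.Nonempty := by
      by_contra hS
      rw [Finset.not_nonempty_iff_eq_empty] at hS
      refine hmin k (Nat.lt_succ_self k) fun d hd => ?_
      rw [hx.expansion d]
      refine Submodule.sub_mem _ (Submodule.sum_mem _ fun i _ => ?_)
        (Submodule.smul_mem _ _ (Submodule.mem_span_singleton_self e))
      rw [hDx d hd i (by simp [hS]), zero_smul]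
      exact Submodule.zero_mem _
    have hle := sum_symmetrized_sq_le (c := fun i j k => B ⁅x i, x j⁆ (x k)) (S := S)
      (fun i j k => by rw [← lie_skew, map_neg, LinearMap.neg_apply])
      (by
        intro k hk i j hj
        obtain ⟨d, hd, a, h⟩ := hSD k hk
        rw [h, add_lie, smul_lie, he, smul_zero, add_zero]
        exact hDx _ (lie_mem_left ℝ g D d (x i) hd) j hj)
      (by
        intro k hk i hi j
        obtain ⟨d, hd, a, h⟩ := hSD k hk
        obtain ⟨d', hd', a', h'⟩ := hSD i hi
        rw [h, h', add_lie, smul_lie, he, smul_zero, add_zero, lie_add, lie_smul, he', smul_zero,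
          add_zero]
        obtain ⟨b, hb⟩ := Submodule.mem_span_singleton.1 (hDD d hd d' hd')
        rw [← hb, map_smul, LinearMap.smul_apply, hs, hx.orthogonal, smul_zero])
    have hsum : ∑ k ∈ S, c = 1 / 2 * ∑ k ∈ S, ∑ j, B ⁅x k, x j⁆ e ^ 2 -
        1 / 4 * (∑ k ∈ S, ∑ i, ∑ j, (B ⁅x k, x i⁆ (x j) + B ⁅x k, x j⁆ (x i)) ^ 2 -
          ∑ k ∈ S, ∑ i, ∑ j, B ⁅x i, x j⁆ (x k) ^ 2) := by
      rw [← Finset.sum_sub_distrib, Finset.mul_sum, Finset.mul_sum, ← Finset.sum_sub_distrib]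
      refine Finset.sum_congr rfl fun k _ => ?_
      have h := einstein_apply_self hx hg he hc (x k)
      rw [hx.apply_self, mul_one] at h
      rw [h]
      simp only [Finset.sum_sub_distrib]
    have hpos : 0 ≤ ∑ k ∈ S, ∑ j, B ⁅x k, x j⁆ e ^ 2 :=
      Finset.sum_nonneg fun k _ => Finset.sum_nonneg fun j _ => sq_nonneg _
    have hfin : 0 ≤ (S.card : ℝ) * c := by
      rw [Finset.sum_const, nsmul_eq_mul] at hsum
      rw [hsum]
      linarith
    exact nonneg_of_mul_nonneg_right hfin (by exact_mod_cast hSne.card_pos)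

theorem einstein_constant_eq_zero_and_lie_orthogonal (hB : IsLorentzian B)
    (hsol : LieAlgebra.IsSolvable g) (hg : IsUnimodular g) (hee : B e e = -1)
    (he : ∀ v : g, ⁅e, v⁆ = 0) (hc : ricciOperator B hB.nondegenerate = c • LinearMap.id) :
    c = 0 ∧ ∀ u v : g, B ⁅u, v⁆ e = 0 := by
  have he' : ∀ v : g, ⁅v, e⁆ = 0 := fun v => by rw [← lie_skew, he, neg_zero]
  obtain ⟨ι, _, x, S, hx, -⟩ := exists_isTimelikeFrame hB hee ⊥ (by simp)
  have h := hx.einstein_timelike hg he hc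
  have hc0 := einstein_constant_nonneg hB hsol hg hee he hc
  have h0 : 0 ≤ ∑ i, ∑ j, B ⁅x i, x j⁆ e ^ 2 :=
    Finset.sum_nonneg fun i _ => Finset.sum_nonneg fun j _ => sq_nonneg _
  have h1 : ∑ i, ∑ j, B ⁅x i, x j⁆ e ^ 2 = 0 := by linarith
  refine ⟨by linarith, fun u v => ?_⟩
  have h2 : ∀ i j, B ⁅x i, x j⁆ e = 0 := fun i j =>
    eq_zero_of_sum_sum_sq_eq_zero h1 (Finset.mem_univ i) (Finset.mem_univ j)
  rw [hx.expansion u, hx.expansion v]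
  simp only [sub_lie, lie_sub, sum_lie, lie_sum, smul_lie,
    lie_smul, he, he', smul_zero, Finset.sum_const_zero, sub_zero, map_sum, map_smul,
    LinearMap.sum_apply, LinearMap.smul_apply, h2]

/-- For `u` orthogonal to the derived algebra, the Einstein equation with constant zero says that a
sum of squares of the coefficients of `ad u + (ad u)*` vanishes. -/
theorem ad_skew_of_orthogonal_derived {ι : Type*} [Fintype ι] {x : ι → g} {hB : B.Nondegenerate}
    (hx : IsTimelikeFrame B e x) (hg : IsUnimodular g) (he : ∀ v : g, ⁅e, v⁆ = 0)
    (hric : ricciOperator B hB = (0 : ℝ) • LinearMap.id) (hlie : ∀ u v : g, B ⁅u, v⁆ e = 0)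
    {u : g} (hu : ∀ v w : g, B ⁅v, w⁆ u = 0) (v w : g) : B ⁅u, v⁆ w = -B ⁅u, w⁆ v := by
  have he' : ∀ v : g, ⁅v, e⁆ = 0 := fun v => by rw [← lie_skew, he, neg_zero]
  have h := einstein_apply_self hx hg he hric u
  simp only [hlie, hu, zero_mul, ne_eq, OfNat.ofNat_ne_zero, not_false_eq_true, zero_pow,
    Finset.sum_const_zero, mul_zero, sub_zero, zero_sub] at h
  have h1 : ∑ i, ∑ j, (B ⁅u, x i⁆ (x j) + B ⁅u, x j⁆ (x i)) ^ 2 = 0 := by linarith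
  have h2 : ∀ i j, B ⁅u, x i⁆ (x j) = -B ⁅u, x j⁆ (x i) := fun i j =>
    eq_neg_of_add_eq_zero_left
      (eq_zero_of_sum_sum_sq_eq_zero h1 (Finset.mem_univ i) (Finset.mem_univ j))
  have h3 : ∀ v w : g, B ⁅u, v⁆ w = ∑ i, ∑ j, B v (x i) * B w (x j) * B ⁅u, x i⁆ (x j) := by
    intro v w
    rw [hx.apply_eq ⁅u, v⁆ w, hlie, zero_mul, sub_zero, Finset.sum_comm]
    refine Finset.sum_congr rfl fun j _ => ?_
    conv_lhs => rw [hx.expansion v]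
    simp only [lie_sub, lie_sum, lie_smul, he', smul_zero, sub_zero, map_sum, map_smul,
      LinearMap.sum_apply, LinearMap.smul_apply, smul_eq_mul, Finset.sum_mul]
    exact Finset.sum_congr rfl fun i _ => by ring
  rw [h3 v w, h3 w v, Finset.sum_comm, ← Finset.sum_neg_distrib]
  refine Finset.sum_congr rfl fun i _ => ?_
  rw [← Finset.sum_neg_distrib]
  refine Finset.sum_congr rfl fun j _ => ?_
  rw [h2 j i]
  ring

/-- The derived algebra is abelian. -/
theorem lie_eq_zero_of_mem_derivedSeries (hB : IsLorentzian B) (hsol : LieAlgebra.IsSolvable g)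
    (hg : IsUnimodular g) (hee : B e e = -1) (he : ∀ v : g, ⁅e, v⁆ = 0)
    (hric : ricciOperator B hB.nondegenerate = (0 : ℝ) • LinearMap.id)
    (hlie : ∀ u v : g, B ⁅u, v⁆ e = 0)
    {u v : g} (hu : u ∈ LieAlgebra.derivedSeries ℝ g 1)
    (hv : v ∈ LieAlgebra.derivedSeries ℝ g 1) : ⁅u, v⁆ = 0 := by
  have hs : ∀ u v, B u v = B v u := fun u v => hB.isSymm.eq u v
  set D := LieAlgebra.derivedSeries ℝ g 1 with hD
  have hmem : ∀ y z : g, ⁅y, z⁆ ∈ D := lie_mem_derivedSeries_one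
  have hDe : ∀ d ∈ D.toSubmodule, B d e = 0 :=
    fun d hd => derivedSeries_one_le (W := LinearMap.ker (B.flip e)) hlie hd
  obtain ⟨ι, _, x, S, hx, hxS, hxS'⟩ := exists_isTimelikeFrame hB hee D.toSubmodule hDe
  have hskew : ∀ u, (∀ v w : g, B ⁅v, w⁆ u = 0) → ∀ v w : g, B ⁅u, v⁆ w = -B ⁅u, w⁆ v :=
    fun u hu => ad_skew_of_orthogonal_derived hx hg he hric hlie hu
  have hort : ∀ j ∉ S, ∀ y z : g, B ⁅y, z⁆ (x j) = 0 := fun j hj y z => hxS' j hj _ (hmem y z)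
  have hzero := eq_zero_of_sum_symmetrized_sq_eq (c := fun i j k => B ⁅x i, x j⁆ (x k)) (S := S)
    (fun i j k => by rw [← lie_skew, map_neg, LinearMap.neg_apply])
    (fun i hi j hj k => by
      rw [lie_eq_zero_of_orthogonal_derived hB.nondegenerate hskew (hort i hi) (hort j hj), map_zero,
        LinearMap.zero_apply])
    (fun i j k hk => hort k hk _ _)
    (by
      intro k hk
      have h := trace_ad_sq_eq_zero_of_mem_derivedSeries (hxS k hk)
      rw [hx.trace_mul_self] at h
      simpa [hlie] using h)
    (by
      intro k _
      have h := einstein_apply_self hx hg he hric (x k)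
      simp only [hlie, zero_mul, ne_eq, OfNat.ofNat_ne_zero, not_false_eq_true, zero_pow,
        Finset.sum_const_zero, mul_zero, zero_sub, Finset.sum_sub_distrib] at h
      linarith)
  have hexp : ∀ d ∈ D, d = ∑ i ∈ S, B d (x i) • x i := by
    intro d hd
    conv_lhs => rw [hx.expansion d, hDe d hd, zero_smul, sub_zero]
    refine (Finset.sum_subset (Finset.subset_univ S) fun j _ hj => ?_).symm
    rw [hxS' j hj d hd, zero_smul]
  have hxx : ∀ i ∈ S, ∀ j ∈ S, ⁅x i, x j⁆ = 0 := by
    intro i hi j hj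
    rw [hx.expansion ⁅x i, x j⁆, hlie, zero_smul, sub_zero]
    exact Finset.sum_eq_zero fun k _ => by rw [hzero i hi j hj k, zero_smul]
  rw [hexp u hu, hexp v hv, sum_lie]
  refine Finset.sum_eq_zero fun i hi => ?_
  rw [lie_sum]
  refine Finset.sum_eq_zero fun j hj => ?_
  rw [smul_lie, lie_smul, hxx i hi j hj, smul_zero, smul_zero]

end Einstein
end LorentzLie

theorem mainTheorem4 {g : Type*} [LieRing g] [LieAlgebra ℝ g] [FiniteDimensional ℝ g]
    (B : LinearMap.BilinForm ℝ g) (hB : LorentzLie.IsLorentzian B)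
    (hEinstein : LorentzLie.IsEinstein B hB.nondegenerate)
    (hSolvable : LieAlgebra.IsSolvable g)
    (hUnimodular : LorentzLie.IsUnimodular g)
    (hCenter : (B.restrict (LieAlgebra.center ℝ g).toSubmodule).Nondegenerate) :
    LorentzLie.IsEuclidean (B.restrict (LieAlgebra.center ℝ g).toSubmodule) ∨
      (LorentzLie.IsFlat B hB.nondegenerate ∧
        ∃ (b : LieIdeal ℝ g) (a : LieSubalgebra ℝ g),
          IsLieAbelian b ∧ IsLieAbelian a ∧ IsCompl b.toSubmodule a.toSubmodule ∧
          (∀ u ∈ a, LorentzLie.leviCivita B hB.nondegenerate u = LieAlgebra.ad ℝ g u) ∧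
          (∀ u ∈ b, LorentzLie.leviCivita B hB.nondegenerate u = 0)) := by
  have hs : ∀ u v, B u v = B v u := fun u v => hB.isSymm.eq u v
  by_cases hpd : (B.restrict (LieAlgebra.center ℝ g).toSubmodule).toQuadraticMap.PosDef
  · exact Or.inl ⟨⟨fun u v => hs u v⟩, hpd⟩
  right
  obtain ⟨⟨z, hz⟩, hzz⟩ := LorentzLie.exists_apply_self_neg
    (B := B.restrict (LieAlgebra.center ℝ g).toSubmodule) ⟨fun u v => hs u v⟩ hCenter hpd
  replace hzz : B z z < 0 := hzz
  have hzc : ∀ v : g, ⁅z, v⁆ = 0 := fun v => by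
    rw [← lie_skew, (LieModule.mem_maxTrivSubmodule ℝ g g z).1 hz v, neg_zero]
  obtain ⟨e, hee, he⟩ : ∃ e : g, B e e = -1 ∧ ∀ v : g, ⁅e, v⁆ = 0 := by
    refine ⟨(Real.sqrt (-B z z))⁻¹ • z, ?_, fun v => by rw [smul_lie, hzc, smul_zero]⟩
    have h1 := Real.mul_self_sqrt (neg_pos.2 hzz).le
    have h2 := (Real.sqrt_pos.2 (neg_pos.2 hzz)).ne'
    simp only [map_smul, LinearMap.smul_apply, smul_eq_mul]
    field_simp
    rw [pow_two, h1, neg_neg]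
  obtain ⟨c, hc⟩ := hEinstein
  obtain ⟨rfl, hlie⟩ := LorentzLie.einstein_constant_eq_zero_and_lie_orthogonal hB hSolvable
    hUnimodular hee he hc
  set b : LieIdeal ℝ g := LieAlgebra.derivedSeries ℝ g 1 with hb
  have hbb : ∀ u ∈ b, ∀ v ∈ b, ⁅u, v⁆ = 0 := fun u hu v hv =>
    LorentzLie.lie_eq_zero_of_mem_derivedSeries hB hSolvable hUnimodular hee he hc hlie hu hv
  have hmem : ∀ y z : g, ⁅y, z⁆ ∈ b := LorentzLie.lie_mem_derivedSeries_one
  have hskew : ∀ u, (∀ v w : g, B ⁅v, w⁆ u = 0) → ∀ v w : g, B ⁅u, v⁆ w = -B ⁅u, w⁆ v := by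
    obtain ⟨ι, _, x, S, hx, -⟩ := LorentzLie.exists_isTimelikeFrame hB hee ⊥ (by simp)
    exact fun u hu => LorentzLie.ad_skew_of_orthogonal_derived hx hUnimodular he hc hlie hu
  have hort : ∀ u ∈ B.orthogonal b.toSubmodule, ∀ y z : g, B ⁅y, z⁆ u = 0 := fun u hu y z =>
    LinearMap.BilinForm.mem_orthogonal_iff.1 hu _ (hmem y z)
  have haa : ∀ u ∈ B.orthogonal b.toSubmodule, ∀ v ∈ B.orthogonal b.toSubmodule, ⁅u, v⁆ = 0 :=
    fun u hu v hv =>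
      LorentzLie.lie_eq_zero_of_orthogonal_derived hB.nondegenerate hskew (hort u hu) (hort v hv)
  let a : LieSubalgebra ℝ g :=
    { B.orthogonal b.toSubmodule with
      lie_mem' := fun {u v} hu hv => by
        rw [haa u hu v hv]
        exact Submodule.zero_mem _ }
  have hcompl : IsCompl b.toSubmodule (B.orthogonal b.toSubmodule) := by
    rw [LinearMap.BilinForm.isCompl_orthogonal_iff_disjoint hB.isSymm.isRefl,
      Submodule.disjoint_def]
    intro v hv hv'
    by_contra hv0
    have hve : B v e = 0 := 
      LorentzLie.derivedSeries_one_le (W := LinearMap.ker (B.flip e)) hlie hv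
    have h1 := hB.pos_of_orthogonal (by rw [hee]; norm_num) hve hv0
    exact h1.ne' (LinearMap.BilinForm.mem_orthogonal_iff.1 hv' v hv)
  -- Koszul's formula characterizes the Levi-Civita product.
  have hLeq : ∀ (u v y : g), (∀ w, B ⁅u, v⁆ w + B ⁅w, u⁆ v + B ⁅w, v⁆ u = 2 * B y w) →
      LorentzLie.leviCivita B hB.nondegenerate u v = y := by
    intro u v y h
    refine sub_eq_zero.1 (hB.nondegenerate.1 _ fun w => ?_)
    have h1 := LorentzLie.two_mul_leviCivita B hB.nondegenerate u v w
    rw [h] at h1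
    rw [map_sub, LinearMap.sub_apply]
    linarith
  have hLa : ∀ u ∈ B.orthogonal b.toSubmodule,
      LorentzLie.leviCivita B hB.nondegenerate u = LieAlgebra.ad ℝ g u := by
    intro u hu
    ext v
    refine hLeq u v _ fun w => ?_
    rw [hort u hu, ← lie_skew w u, map_neg, LinearMap.neg_apply, hskew u (hort u hu) w v,
      LieAlgebra.ad_apply]
    ring
  have hLb : ∀ u ∈ b, LorentzLie.leviCivita B hB.nondegenerate u = 0 := by
    intro u hu
    have hsplit : ∀ v : g, ∃ y ∈ b.toSubmodule, ∃ z ∈ B.orthogonal b.toSubmodule, y + z = v :=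
      fun v => Submodule.mem_sup.1 (by rw [hcompl.sup_eq_top]; trivial)
    have hLba : ∀ v ∈ B.orthogonal b.toSubmodule,
        LorentzLie.leviCivita B hB.nondegenerate u v = 0 := by
      intro v hv
      refine hLeq u v 0 fun w => ?_
      rw [hort v hv, ← lie_skew u v, map_neg, LinearMap.neg_apply, hskew v (hort v hv) u w,
        ← lie_skew w v]
      simp only [map_neg, LinearMap.neg_apply, map_zero, LinearMap.zero_apply]
      ring
    have hLbb : ∀ v ∈ b, LorentzLie.leviCivita B hB.nondegenerate u v = 0 := by
      intro v hv
      refine hLeq u v 0 fun w => ?_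
      obtain ⟨y, hy, z, hz, rfl⟩ := hsplit w
      rw [hbb u hu v hv, add_lie, add_lie, hbb y hy u hu, hbb y hy v hv, zero_add, zero_add,
        hskew z (hort z hz) u v]
      simp
    ext v
    obtain ⟨y, hy, z, hz, rfl⟩ := hsplit v
    rw [map_add, hLbb y hy, hLba z hz, add_zero, LinearMap.zero_apply]
  refine ⟨fun u v => ?_, b, a, ⟨fun u v => Subtype.ext (hbb u u.2 v v.2)⟩,
    ⟨fun u v => Subtype.ext (haa u u.2 v v.2)⟩, hcompl, hLa, hLb⟩
  -- Every `L_u` is `ad z` with `z` in the abelian algebra `b⊥`, so the operators `L_u` commute.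
  have hLrange : ∀ u, ∃ z ∈ B.orthogonal b.toSubmodule,
      LorentzLie.leviCivita B hB.nondegenerate u = LieAlgebra.ad ℝ g z := by
    intro u
    obtain ⟨y, hy, z, hz, rfl⟩ := Submodule.mem_sup.1
      (show u ∈ b.toSubmodule ⊔ B.orthogonal b.toSubmodule by rw [hcompl.sup_eq_top]; trivial)
    exact ⟨z, hz, by rw [map_add, hLb y hy, hLa z hz, zero_add]⟩
  obtain ⟨y, hy, hLy⟩ := hLrange u
  obtain ⟨z, hz, hLz⟩ := hLrange v
  have hK : LorentzLie.curvature B hB.nondegenerate u v =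
      LorentzLie.leviCivita B hB.nondegenerate ⁅u, v⁆ -
        ⁅LorentzLie.leviCivita B hB.nondegenerate u,
          LorentzLie.leviCivita B hB.nondegenerate v⁆ := rfl
  rw [hK, hLb _ (hmem u v), hLy, hLz, LieRing.of_associative_ring_bracket]
  ext w
  simp only [LinearMap.sub_apply, LinearMap.zero_apply, Module.End.mul_apply, LieAlgebra.ad_apply]
  rw [leibniz_lie y z w, haa y hy z hz, zero_lie]
  abel
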